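/- Let $X$ be a compact complex manifold and let $h\in\mathbb{R}\setminus\{0\}$. Let $C^\infty_k(X,\mathbb{C})$ be the space of smooth $\mathbb{C}$-valued $k$-forms on $X$ (it is $0$ for $k<0$). For $a\in\mathbb{R}\setminus\{0\}$ put $d_a:=a\,\partial+\bar\partial: C^\infty_k(X,\mathbb{C})\to C^\infty_{k+1}(X,\mathbb{C})$. Kernels and images below are taken in $C^\infty_k(X,\mathbb{C})$, and $$H^k_{h-BC}=\frac{\ker d_h\cap\ker d_{-1/h}}{\operatorname{Im}(d_hd_{-1/h})},\qquad H^k_{h-A}=\frac{\ker(d_hd_{-1/h})}{\operatorname{Im}d_h+\operatorname{Im}d_{-1/h}},\qquad H^k_{d_a}=\frac{\ker d_a}{\operatorname{Im}d_a}.$$ All maps between these spaces are the canonical ones, induced by the identity on forms. Then for every integer $k\geq 1$ the following properties are equivalent: - $(L_k)$: for every $k$-form $u\in\ker d_h\cap\ker d_{-1/h}$, $\;u\in\operatorname{Im}d_h\iff u\in\operatorname{Im}d_{-1/h}\iff u\in\operatorname{Im}(d_hd_{-1/h})\iff u\in\operatorname{Im}(\partial\bar\partial)$; - $(A_k)$: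 the map $H^k_{h-BC}\to H^k_{h-A}$ is injective; - $(C_k)$: the maps $H^k_{h-BC}\to H^k_{d_{-1/h}}$ and $H^k_{h-BC}\to H^k_{d_h}$ are both injective; - $(D'_{k-1})$: $\operatorname{Im}d_h+\ker d_{-1/h}=\ker(d_hd_{-1/h})$ and $\operatorname{Im}d_{-1/h}+\ker d_h=\ker(d_hd_{-1/h})$ as subspaces of $C^\infty_{k-1}(X,\mathbb{C})$; - $(B_{k-1})$: the map $H^{k-1}_{h-BC}\to H^{k-1}_{h-A}$ is surjective. -/

import Mathlib

open scoped Manifold ContDiff Topology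

namespace ComplexForms

noncomputable section

set_option maxSynthPendingDepth 3

section Local

variable {E : Type*} [NormedAddCommGroup E] [NormedSpace ℂ E] {k : ℕ}

/-- Multiplication by the imaginary unit, as a real-linear map (the complex structure of `E`). -/
def mulI (E : Type*) [NormedAddCommGroup E] [NormedSpace ℂ E] : E →L[ℝ] E :=
  (Complex.I • ContinuousLinearMap.id ℂ E).restrictScalars ℝ

@[simp] lemma mulI_apply (v : E) : mulI E v = Complex.I • v := rfl

/-- For `s = i` this is the `ℂ`-linear part `v ↦ (L v - i L (i v)) / 2` of the real-linear map `L`,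
and for `s = -i` it is the `ℂ`-antilinear part `v ↦ (L v + i L (i v)) / 2`. Applied to the
differential of a form `η` on an open set of `ℂⁿ` these are `∑ⱼ dzⱼ ⊗ ∂η/∂zⱼ` and
`∑ⱼ dz̄ⱼ ⊗ ∂η/∂z̄ⱼ`, the derivatives acting on the coefficients of `η`. -/
def wirtinger (s : ℂ) (L : E →L[ℝ] E [⋀^Fin k]→L[ℝ] ℂ) : E →L[ℝ] E [⋀^Fin k]→L[ℝ] ℂ :=
  (1 / 2 : ℂ) • (L - s • L ∘L mulI E)

lemma wirtinger_apply (s : ℂ) (L : E →L[ℝ] E [⋀^Fin k]→L[ℝ] ℂ) (v : E) :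
    wirtinger s L v = (1 / 2 : ℂ) • (L v - s • L (Complex.I • v)) := rfl

/-- The operators `∂` (for `s = i`) and `∂̄` (for `s = -i`) on complex-valued differential forms on
an open set of a complex vector space: `∂η = ∑ⱼ dzⱼ ∧ ∂η/∂zⱼ` and `∂̄η = ∑ⱼ dz̄ⱼ ∧ ∂η/∂z̄ⱼ`.
The alternatization is the one in `extDeriv`; only the differential of `η` has been replaced by
its `ℂ`-linear, respectively `ℂ`-antilinear part. -/
def dLoc (s : ℂ) (η : E → E [⋀^Fin k]→L[ℝ] ℂ) (x : E) : E [⋀^Fin (k + 1)]→L[ℝ] ℂ :=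
  .alternatizeUncurryFin (wirtinger s (fderiv ℝ η x))

/-- `∂ + ∂̄ = d`. -/
lemma dLoc_add_dLoc (η : E → E [⋀^Fin k]→L[ℝ] ℂ) (x : E) :
    dLoc Complex.I η x + dLoc (-Complex.I) η x = extDeriv η x := by
  unfold dLoc extDeriv
  rw [← ContinuousAlternatingMap.alternatizeUncurryFin_add]
  congr 1
  ext1 v
  simp only [add_apply, wirtinger_apply]
  module

lemma contDiffOn_dLoc (s : ℂ) {η : E → E [⋀^Fin k]→L[ℝ] ℂ} {U : Set E} (hU : IsOpen U)
    (hη : ContDiffOn ℝ ∞ η U) : ContDiffOn ℝ ∞ (dLoc s η) U := by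
  have h1 : ContDiffOn ℝ ∞ (fderiv ℝ η) U := hη.fderiv_of_isOpen hU (by simp)
  have h2 : ContDiffOn ℝ ∞ (fun x => wirtinger s (fderiv ℝ η x)) U := by
    unfold wirtinger
    have := h1.clm_comp (contDiffOn_const (c := mulI E))
    exact (h1.sub (this.const_smul s)).const_smul _
  exact (ContinuousAlternatingMap.alternatizeUncurryFinCLM ℝ E ℂ).contDiff.comp_contDiffOn h2

/-- `wirtinger s` as a continuous linear map. -/
def wirtingerCLM (s : ℂ) :
    (E →L[ℝ] E [⋀^Fin k]→L[ℝ] ℂ) →L[ℝ] (E →L[ℝ] E [⋀^Fin k]→L[ℝ] ℂ) :=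
  (1 / 2 : ℂ) • (ContinuousLinearMap.id ℝ _ -
    s • (ContinuousLinearMap.compL ℝ E E (E [⋀^Fin k]→L[ℝ] ℂ)).flip (mulI E))

/-- Specializes to `∂² = 0`, `∂̄² = 0` and `∂∂̄ + ∂̄∂ = 0`. -/
lemma dLoc_dLoc_anticomm (s t : ℂ) {η : E → E [⋀^Fin k]→L[ℝ] ℂ} {x : E}
    (hη : ContDiffAt ℝ 2 η x) :
    dLoc s (dLoc t η) x + dLoc t (dLoc s η) x = 0 := by
  have hd : DifferentiableAt ℝ (fderiv ℝ η) x :=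
    (hη.fderiv_right (m := 1) (by norm_num)).differentiableAt (by simp)
  have key : ∀ r : ℂ, fderiv ℝ (dLoc r η) x =
      ContinuousAlternatingMap.alternatizeUncurryFinCLM ℝ E ℂ ∘L
        (wirtingerCLM r ∘L fderiv ℝ (fderiv ℝ η) x) := by
    intro r
    have h1 : HasFDerivAt (fun y => wirtingerCLM r (fderiv ℝ η y))
        (wirtingerCLM r ∘L fderiv ℝ (fderiv ℝ η) x) x :=
      HasFDerivAt.comp x (wirtingerCLM r (E := E) (k := k)).hasFDerivAt hd.hasFDerivAt
    have h2 := (ContinuousAlternatingMap.alternatizeUncurryFinCLM ℝ E ℂ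
      (n := k)).hasFDerivAt.comp x h1
    exact h2.fderiv
  have hsymm : ∀ v w, fderiv ℝ (fderiv ℝ η) x v w = fderiv ℝ (fderiv ℝ η) x w v :=
    hη.isSymmSndFDerivAt (by simp)
  set D := fderiv ℝ (fderiv ℝ η) x with hD
  let G : ℂ → ℂ → (E →L[ℝ] E →L[ℝ] E [⋀^Fin k]→L[ℝ] ℂ) := fun s t =>
    (1 / 2 : ℂ) • ((wirtingerCLM t (E := E) (k := k)).comp D -
      s • ((wirtingerCLM t (E := E) (k := k)).comp D).comp (mulI E))
  have hG : ∀ s t v w, G s t v w = (1 / 2 : ℂ) • ((1 / 2 : ℂ) •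
      (D v w - t • D v (Complex.I • w)) - s • (1 / 2 : ℂ) •
      (D (Complex.I • v) w - t • D (Complex.I • v) (Complex.I • w))) := fun s t v w => rfl
  have key2 : ∀ s t : ℂ, wirtinger s (fderiv ℝ (dLoc t η) x) =
      ContinuousAlternatingMap.alternatizeUncurryFinCLM ℝ E ℂ ∘L G s t := by
    intro s t
    ext1 v
    rw [wirtinger_apply, key]
    simp only [ContinuousLinearMap.comp_apply,
      ContinuousAlternatingMap.alternatizeUncurryFinCLM_apply]
    change _ = ContinuousAlternatingMap.alternatizeUncurryFin
      ((1 / 2 : ℂ) • (wirtingerCLM t (D v) - s • wirtingerCLM t (D (Complex.I • v))))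
    rw [ContinuousAlternatingMap.alternatizeUncurryFin_smul, sub_eq_add_neg, sub_eq_add_neg,
      ContinuousAlternatingMap.alternatizeUncurryFin_add, ← neg_smul, ← neg_smul,
      ContinuousAlternatingMap.alternatizeUncurryFin_smul]
  unfold dLoc
  change ContinuousAlternatingMap.alternatizeUncurryFin (wirtinger s (fderiv ℝ (dLoc t η) x)) +
    ContinuousAlternatingMap.alternatizeUncurryFin (wirtinger t (fderiv ℝ (dLoc s η) x)) = 0
  rw [key2, key2, ← ContinuousAlternatingMap.alternatizeUncurryFin_add,
    ← ContinuousLinearMap.comp_add]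
  apply ContinuousAlternatingMap.alternatizeUncurryFin_alternatizeUncurryFinCLM_comp_of_symmetric
  intro v w
  simp only [add_apply, hG]
  rw [hsymm w v, hsymm w (Complex.I • v), hsymm (Complex.I • w) v,
    hsymm (Complex.I • w) (Complex.I • v)]
  module

lemma dLoc_congr (s : ℂ) {η η' : E → E [⋀^Fin k]→L[ℝ] ℂ} {x : E} (h : η =ᶠ[𝓝 x] η') :
    dLoc s η x = dLoc s η' x := by
  unfold dLoc; rw [h.fderiv_eq]

/-- `∂` and `∂̄` commute with pullback under holomorphic maps. -/
lemma dLoc_pullback (s : ℂ) {η : E → E [⋀^Fin k]→L[ℝ] ℂ} {f : E → E} {x : E}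
    (hη : DifferentiableAt ℝ η (f x)) (hf : ContDiffAt ℂ 2 f x) :
    dLoc s (fun y => (η (f y)).compContinuousLinearMap ((fderiv ℂ f y).restrictScalars ℝ)) x =
      (dLoc s η (f x)).compContinuousLinearMap ((fderiv ℂ f x).restrictScalars ℝ) := by
  have hf1 : DifferentiableAt ℂ f x := hf.differentiableAt (by simp)
  have hf2 : DifferentiableAt ℂ (fderiv ℂ f) x :=
    (hf.fderiv_right (m := 1) (by norm_num)).differentiableAt (by simp)
  have hsymm : ∀ v w, fderiv ℂ (fderiv ℂ f) x v w = fderiv ℂ (fderiv ℂ f) x w v :=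
    hf.isSymmSndFDerivAt (by simp)
  set D := fderiv ℂ (fderiv ℂ f) x with hD
  let g' : E →L[ℝ] E →L[ℝ] E :=
    (ContinuousLinearMap.restrictScalarsL ℂ E E ℝ ℝ) ∘L D.restrictScalars ℝ
  have hg : HasFDerivAt (fun y => (fderiv ℂ f y).restrictScalars ℝ) g' x :=
    (ContinuousLinearMap.restrictScalarsL ℂ E E ℝ ℝ).hasFDerivAt.comp x
      (hf2.hasFDerivAt.restrictScalars ℝ)
  have hc : HasFDerivAt (fun y => η (f y))
      (fderiv ℝ η (f x) ∘L (fderiv ℂ f x).restrictScalars ℝ) x :=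
    hη.hasFDerivAt.comp x (hf1.hasFDerivAt.restrictScalars ℝ)
  have h := (hc.continuousAlternatingMapCompContinuousLinearMap hg).fderiv
  unfold dLoc
  rw [h]
  set A := (fderiv ℂ f x).restrictScalars ℝ with hA
  have hAI : ∀ v, A (Complex.I • v) = Complex.I • A v := fun v => (fderiv ℂ f x).map_smul _ _
  let T := (η (f x)).fderivCompContinuousLinearMap A
  have e1 : wirtinger s (ContinuousAlternatingMap.compContinuousLinearMapCLM A ∘L
      (fderiv ℝ η (f x) ∘L A) + T ∘L g') =
      ContinuousAlternatingMap.compContinuousLinearMapCLM A ∘L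
        (wirtinger s (fderiv ℝ η (f x)) ∘L A) +
      (1 / 2 : ℂ) • (T ∘L g' + (-s) • T ∘L (g' ∘L mulI E)) := by
    ext v w
    simp [wirtinger_apply, hAI]
    ring
  rw [e1, ContinuousAlternatingMap.alternatizeUncurryFin_add,
    ContinuousAlternatingMap.alternatizeUncurryFin_smul,
    ContinuousAlternatingMap.alternatizeUncurryFin_add,
    ContinuousAlternatingMap.alternatizeUncurryFin_smul,
    ContinuousAlternatingMap.alternatizeUncurryFin_fderivCompContinuousLinearMap_eq_zero,
    ContinuousAlternatingMap.alternatizeUncurryFin_fderivCompContinuousLinearMap_eq_zero]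
  · ext v
    simp [ContinuousAlternatingMap.alternatizeUncurryFin_apply, Fin.removeNth, Function.comp_def]
    rfl
  · intro v w
    change D (Complex.I • v) w = D (Complex.I • w) v
    simp [hsymm v w]
  · intro v w
    exact hsymm v w

end Local

section Manifold

variable {E : Type*} [NormedAddCommGroup E] [NormedSpace ℂ E]
  {X : Type*} [TopologicalSpace X] [ChartedSpace E X]

/-- The complex-valued `ℝ`-multilinear alternating `k`-forms on the (real) tangent space of the
complex manifold `X` at `x`. -/
abbrev Covector (E : Type*) [NormedAddCommGroup E] [NormedSpace ℂ E]
    {X : Type*} [TopologicalSpace X] [ChartedSpace E X] (k : ℕ) (x : X) : Type _ :=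
  TangentSpace 𝓘(ℂ, E) x [⋀^Fin k]→L[ℝ] ℂ

/-- The expression of a `k`-form `u` on `X` in the chart `e`: its pullback under the inverse of `e`.
It is meaningful on `e.target`. -/
def chartRep {k : ℕ} (e : OpenPartialHomeomorph X E) (u : ∀ x : X, Covector E k x) (y : E) :
    E [⋀^Fin k]→L[ℝ] ℂ :=
  (u (e.symm y)).compContinuousLinearMap
    ((mfderiv 𝓘(ℂ, E) 𝓘(ℂ, E) e.symm y).restrictScalars ℝ)

variable (E X) in
/-- The space of complex-valued `k`-forms on `X` that are `C^∞` (in the real sense) in every chart,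
as a subspace of the space of all `k`-forms. -/
def smoothForms (k : ℕ) : Submodule ℂ (∀ x : X, Covector E k x) where
  carrier := {u | ∀ e ∈ atlas E X, ContDiffOn ℝ ∞ (chartRep e u) e.target}
  add_mem' hu hv e he := (hu e he).add (hv e he)
  zero_mem' _ _ := contDiffOn_const (c := 0)
  smul_mem' c _ hu e he := (hu e he).const_smul c

variable (E X) in
/-- The space `C^∞_k(X, ℂ)` of smooth complex-valued `k`-forms on `X`. -/
def Form (k : ℕ) : Type _ := smoothForms E X k

instance (k : ℕ) : AddCommGroup (Form E X k) := inferInstanceAs (AddCommGroup (smoothForms E X k))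

instance (k : ℕ) : Module ℂ (Form E X k) := inferInstanceAs (Module ℂ (smoothForms E X k))

/-- `∂` (for `s = i`) and `∂̄` (for `s = -i`) of a form on `X`, computed at `x` in the preferred chart
at `x`; by `chartRep_dPre` below any chart gives the same result. -/
def dPre {k : ℕ} (s : ℂ) (u : ∀ x : X, Covector E k x) (x : X) : Covector E (k + 1) x :=
  (dLoc s (chartRep (chartAt E x) u) (chartAt E x x)).compContinuousLinearMap
    ((mfderiv 𝓘(ℂ, E) 𝓘(ℂ, E) (chartAt E x) x).restrictScalars ℝ)


lemma differentiableAt_chartRep {k : ℕ} {u : ∀ x : X, Covector E k x}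
    (hu : u ∈ smoothForms E X k) (x : X) :
    DifferentiableAt ℝ (chartRep (chartAt E x) u) (chartAt E x x) :=
  ((hu _ (chart_mem_atlas E x)).contDiffAt ((chartAt E x).open_target.mem_nhds
    ((chartAt E x).map_source (mem_chart_source E x)))).differentiableAt (by simp)

section Aux

variable [IsManifold 𝓘(ℂ, E) ω X]

lemma isManifold_one : IsManifold 𝓘(ℂ, E) 1 X := .of_le (n := ω) (by simp)

lemma contDiffAt_transition {e e' : OpenPartialHomeomorph X E} (he : e ∈ atlas E X)
    (he' : e' ∈ atlas E X) {y : E} (hy : y ∈ e.target) (hy' : e.symm y ∈ e'.source) :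
    ContDiffAt ℂ ω (e' ∘ e.symm) y := by
  have h := (contDiffGroupoid ω 𝓘(ℂ, E)).compatible he he'
  rw [contDiffGroupoid, mem_groupoid_of_pregroupoid] at h
  have h1 : ContDiffOn ℂ ω (e' ∘ e.symm) (e.symm ≫ₕ e').source := by
    simpa [contDiffPregroupoid] using h.1
  exact h1.contDiffAt ((e.symm ≫ₕ e').open_source.mem_nhds (by simp [hy, hy']))

lemma fderiv_transition {e e' : OpenPartialHomeomorph X E} (he : e ∈ atlas E X)
    (he' : e' ∈ atlas E X) {y : E} (hy : y ∈ e.target) (hy' : e.symm y ∈ e'.source) :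
    fderiv ℂ (e' ∘ e.symm) y = (mfderiv 𝓘(ℂ, E) 𝓘(ℂ, E) e' (e.symm y)).comp
      (mfderiv 𝓘(ℂ, E) 𝓘(ℂ, E) e.symm y) := by
  have := isManifold_one (E := E) (X := X)
  rw [← mfderiv_eq_fderiv]
  exact mfderiv_comp y (mdifferentiableAt_atlas he' hy') (mdifferentiableAt_atlas_symm he hy)

lemma eq_chartRep {k : ℕ} {e : OpenPartialHomeomorph X E} (he : e ∈ atlas E X)
    (u : ∀ x : X, Covector E k x) {x : X} (hx : x ∈ e.source) :
    u x = (chartRep e u (e x)).compContinuousLinearMap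
      ((mfderiv 𝓘(ℂ, E) 𝓘(ℂ, E) e x).restrictScalars ℝ) := by
  have := isManifold_one (E := E) (X := X)
  have h := (mdifferentiable_of_mem_atlas (I := 𝓘(ℂ, E)) he).symm_comp_deriv hx
  let u' : X → E [⋀^Fin k]→L[ℝ] ℂ := u
  have h0 : u' (e.symm (e x)) = u' x := by rw [e.left_inv hx]
  change u' x = ContinuousAlternatingMap.compContinuousLinearMap
    (ContinuousAlternatingMap.compContinuousLinearMap (u' (e.symm (e x))) _) _
  rw [h0]
  ext v
  change u' x v = u' x (fun i => ((mfderiv 𝓘(ℂ, E) 𝓘(ℂ, E) e.symm (e x)).comp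
    (mfderiv 𝓘(ℂ, E) 𝓘(ℂ, E) e x)) (v i))
  rw [h]
  rfl

lemma chartRep_eq {k : ℕ} {e e' : OpenPartialHomeomorph X E} (he : e ∈ atlas E X)
    (he' : e' ∈ atlas E X) (u : ∀ x : X, Covector E k x)
    {y : E} (hy : y ∈ e.target) (hy' : e.symm y ∈ e'.source) :
    chartRep e u y = (chartRep e' u ((e' ∘ e.symm) y)).compContinuousLinearMap
      ((fderiv ℂ (e' ∘ e.symm) y).restrictScalars ℝ) := by
  rw [fderiv_transition he he' hy hy']
  unfold chartRep
  rw [eq_chartRep he' u hy']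
  rfl

/-- In every chart, `dPre s u` is expressed by the local operator. -/
lemma chartRep_dPre {k : ℕ} (s : ℂ) {u : ∀ x : X, Covector E k x}
    (hu : u ∈ smoothForms E X k) {e : OpenPartialHomeomorph X E} (he : e ∈ atlas E X)
    {y : E} (hy : y ∈ e.target) :
    chartRep e (dPre s u) y = dLoc s (chartRep e u) y := by
  set x := e.symm y with hx
  set e' := chartAt E x with he'
  have ha' : e' ∈ atlas E X := chart_mem_atlas E x
  have hx' : x ∈ e'.source := mem_chart_source E x
  have hd : DifferentiableAt ℝ (chartRep e' u) ((e' ∘ e.symm) y) :=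
    ((hu e' ha').contDiffAt (e'.open_target.mem_nhds (e'.map_source hx'))).differentiableAt
      (by simp)
  have hf := contDiffAt_transition he ha' hy hx'
  have h1 := dLoc_pullback s hd (hf.of_le le_top)
  have hev : chartRep e u =ᶠ[𝓝 y] fun z =>
      (chartRep e' u ((e' ∘ e.symm) z)).compContinuousLinearMap
        ((fderiv ℂ (e' ∘ e.symm) z).restrictScalars ℝ) := by
    have hn : (e.symm ≫ₕ e').source ∈ 𝓝 y :=
      (e.symm ≫ₕ e').open_source.mem_nhds (by simp [hy, ← hx, hx'])
    filter_upwards [hn] with z hz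
    simp only [OpenPartialHomeomorph.trans_source, OpenPartialHomeomorph.symm_source,
      Set.mem_inter_iff, Set.mem_preimage] at hz
    exact chartRep_eq he ha' u hz.1 hz.2
  rw [dLoc_congr s hev, h1, fderiv_transition he ha' hy hx']
  rfl

lemma dPre_mem {k : ℕ} (s : ℂ) {u : ∀ x : X, Covector E k x}
    (hu : u ∈ smoothForms E X k) : dPre s u ∈ smoothForms E X (k + 1) := fun e he =>
  (contDiffOn_dLoc s e.open_target (hu e he)).congr fun _ hy => chartRep_dPre s hu he hy

lemma dLoc_add (s : ℂ) {k : ℕ} {η θ : E → E [⋀^Fin k]→L[ℝ] ℂ} {x : E}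
    (hη : DifferentiableAt ℝ η x) (hθ : DifferentiableAt ℝ θ x) :
    dLoc s (η + θ) x = dLoc s η x + dLoc s θ x := by
  unfold dLoc
  rw [fderiv_add hη hθ, ← ContinuousAlternatingMap.alternatizeUncurryFin_add]
  congr 1
  ext1 v
  simp only [wirtinger_apply, add_apply]
  module

lemma dLoc_smul (s c : ℂ) {k : ℕ} {η : E → E [⋀^Fin k]→L[ℝ] ℂ} {x : E}
    (hη : DifferentiableAt ℝ η x) :
    dLoc s (c • η) x = c • dLoc s η x := by
  unfold dLoc
  rw [fderiv_const_smul hη, ← ContinuousAlternatingMap.alternatizeUncurryFin_smul]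
  congr 1
  ext1 v
  simp only [wirtinger_apply, smul_apply]
  module

variable (E X) in
/-- `∂` (for `s = i`) and `∂̄` (for `s = -i`) as linear maps on smooth forms. -/
def dOp (s : ℂ) (k : ℕ) : Form E X k →ₗ[ℂ] Form E X (k + 1) where
  toFun u := (⟨dPre s u.1, dPre_mem s u.2⟩ : smoothForms E X (k + 1))
  map_add' u v := by
    refine Subtype.ext (funext fun x => ?_)
    have h := dLoc_add s (differentiableAt_chartRep u.2 x) (differentiableAt_chartRep v.2 x)
    change ContinuousAlternatingMap.compContinuousLinearMap (dLoc s (chartRep (chartAt E x) u.1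
      + chartRep (chartAt E x) v.1) (chartAt E x x)) _ = _
    rw [h]; rfl
  map_smul' c u := by
    refine Subtype.ext (funext fun x => ?_)
    have h := dLoc_smul s c (differentiableAt_chartRep u.2 x)
    change ContinuousAlternatingMap.compContinuousLinearMap
      (dLoc s (c • chartRep (chartAt E x) u.1) (chartAt E x x)) _ = _
    rw [h]; rfl

lemma dOp_anticomm (s t : ℂ) (k : ℕ) (u : Form E X k) :
    dOp E X s (k + 1) (dOp E X t k u) + dOp E X t (k + 1) (dOp E X s k u) = 0 := by
  refine Subtype.ext (funext fun x => ?_)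
  set e := chartAt E x
  have he : e ∈ atlas E X := chart_mem_atlas E x
  have hx : e x ∈ e.target := e.map_source (mem_chart_source E x)
  have hn : e.target ∈ 𝓝 (e x) := e.open_target.mem_nhds hx
  have key : ∀ r q : ℂ, dLoc r (chartRep e (dPre q u.1)) (e x) =
      dLoc r (dLoc q (chartRep e u.1)) (e x) := fun r q =>
    dLoc_congr r (by filter_upwards [hn] with y hy using chartRep_dPre q u.2 he hy)
  have h := dLoc_dLoc_anticomm s t (((u.2 e he).contDiffAt hn).of_le (m := 2)
    (WithTop.coe_le_coe.2 le_top))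
  rw [← key, ← key] at h
  change ContinuousAlternatingMap.compContinuousLinearMap
    (dLoc s (chartRep e (dPre t u.1)) (e x) + dLoc t (chartRep e (dPre s u.1)) (e x)) _ = _
  rw [h]; rfl


variable (E X) in
/-- `∂ : C^∞_k(X, ℂ) → C^∞_{k+1}(X, ℂ)`. -/
def del (k : ℕ) : Form E X k →ₗ[ℂ] Form E X (k + 1) := dOp E X Complex.I k

variable (E X) in
/-- `∂̄ : C^∞_k(X, ℂ) → C^∞_{k+1}(X, ℂ)`. -/
def delbar (k : ℕ) : Form E X k →ₗ[ℂ] Form E X (k + 1) := dOp E X (-Complex.I) k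

variable (E X) in
/-- `d_h = h ∂ + ∂̄ : C^∞_k(X, ℂ) → C^∞_{k+1}(X, ℂ)`. -/
def dh (h : ℝ) (k : ℕ) : Form E X k →ₗ[ℂ] Form E X (k + 1) :=
  (h : ℂ) • del E X k + delbar E X k

variable (E X) in
/-- `d_h d_{-1/h} : C^∞_k(X, ℂ) → C^∞_{k+2}(X, ℂ)`. -/
def dhdh (h : ℝ) (k : ℕ) : Form E X k →ₗ[ℂ] Form E X (k + 2) :=
  dh E X h (k + 1) ∘ₗ dh E X (-h⁻¹) k

lemma dh_anticomm (a b : ℝ) (k : ℕ) (u : Form E X k) :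
    dh E X a (k + 1) (dh E X b k u) + dh E X b (k + 1) (dh E X a k u) = 0 := by
  have h1 := dOp_anticomm (E := E) (X := X) Complex.I Complex.I k u
  have h2 := dOp_anticomm (E := E) (X := X) Complex.I (-Complex.I) k u
  have h3 := dOp_anticomm (E := E) (X := X) (-Complex.I) (-Complex.I) k u
  have e : dh E X a (k + 1) (dh E X b k u) + dh E X b (k + 1) (dh E X a k u) =
      ((a * b : ℝ) : ℂ) • (dOp E X Complex.I (k + 1) (dOp E X Complex.I k u)
        + dOp E X Complex.I (k + 1) (dOp E X Complex.I k u))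
      + ((a + b : ℝ) : ℂ) • (dOp E X Complex.I (k + 1) (dOp E X (-Complex.I) k u)
        + dOp E X (-Complex.I) (k + 1) (dOp E X Complex.I k u))
      + (dOp E X (-Complex.I) (k + 1) (dOp E X (-Complex.I) k u)
        + dOp E X (-Complex.I) (k + 1) (dOp E X (-Complex.I) k u)) := by
    simp only [dh, del, delbar, LinearMap.add_apply, LinearMap.smul_apply, map_add, map_smul]
    push_cast
    module
  rw [e, h1, h2, h3]
  simp

variable (E X) in
/-- The image of `d_h` in the space of `k`-forms (there are no forms of negative degree). -/
def imDh (h : ℝ) : (k : ℕ) → Submodule ℂ (Form E X k)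
  | 0 => ⊥
  | k + 1 => LinearMap.range (dh E X h k)

variable (E X) in
/-- The image of `d_h d_{-1/h}` in the space of `k`-forms. -/
def imDhDh (h : ℝ) : (k : ℕ) → Submodule ℂ (Form E X k)
  | 0 => ⊥
  | 1 => ⊥
  | k + 2 => LinearMap.range (dhdh E X h k)

variable (E X) in
/-- The image of `∂∂̄` in the space of `k`-forms. -/
def imDelDelbar : (k : ℕ) → Submodule ℂ (Form E X k)
  | 0 => ⊥
  | 1 => ⊥
  | k + 2 => LinearMap.range (del E X (k + 1) ∘ₗ delbar E X k)

variable (E X) in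
/-- `ker d_h ∩ ker d_{-1/h}` in the space of `k`-forms. -/
abbrev kerBC (h : ℝ) (k : ℕ) : Submodule ℂ (Form E X k) :=
  LinearMap.ker (dh E X h k) ⊓ LinearMap.ker (dh E X (-h⁻¹) k)

variable (E X) in
/-- `Im d_h + Im d_{-1/h}` in the space of `k`-forms. -/
abbrev imA (h : ℝ) (k : ℕ) : Submodule ℂ (Form E X k) :=
  imDh E X h k ⊔ imDh E X (-h⁻¹) k

lemma imDhDh_le (h : ℝ) (k : ℕ) : imDhDh E X h k ≤ imDh E X h k := by
  match k with
  | 0 => exact bot_le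
  | 1 => exact bot_le
  | k + 2 => exact LinearMap.range_comp_le_range _ _

lemma imDhDh_le' (h : ℝ) (k : ℕ) : imDhDh E X h k ≤ imDh E X (-h⁻¹) k := by
  match k with
  | 0 => exact bot_le
  | 1 => exact bot_le
  | k + 2 =>
    rintro _ ⟨v, rfl⟩
    refine ⟨-dh E X h k v, ?_⟩
    rw [map_neg]
    exact (eq_neg_of_add_eq_zero_left (dh_anticomm h (-h⁻¹) k v)).symm

lemma ker_dh_le (h : ℝ) (k : ℕ) :
    LinearMap.ker (dh E X (-h⁻¹) k) ≤ LinearMap.ker (dhdh E X h k) :=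
  LinearMap.ker_le_ker_comp _ _

/-- The quotient `Z / (Z ∩ B)`; it is `Z / B` when `B ⊆ Z`, as in all the uses below. -/
abbrev Subquotient {V : Type*} [AddCommGroup V] [Module ℂ V] (Z B : Submodule ℂ V) : Type _ :=
  Z ⧸ B.submoduleOf Z

/-- The map `[u] ↦ [u]` from `Z / B` to `Z' / B'` if `Z ⊆ Z'` and `B ⊆ B'`. -/
def Subquotient.map {V : Type*} [AddCommGroup V] [Module ℂ V] {Z Z' B B' : Submodule ℂ V}
    (hZ : Z ≤ Z') (hB : B ≤ B') : Subquotient Z B →ₗ[ℂ] Subquotient Z' B' :=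
  Submodule.mapQ _ _ (Submodule.inclusion hZ) fun _ hx => hB hx

variable (E X) in
/-- The `h`-Bott-Chern cohomology `H^k_{h-BC}(X, ℂ) = (ker d_h ∩ ker d_{-1/h}) / Im (d_h d_{-1/h})`. -/
abbrev HBC (h : ℝ) (k : ℕ) : Type _ := Subquotient (kerBC E X h k) (imDhDh E X h k)

variable (E X) in
/-- The `h`-Aeppli cohomology `H^k_{h-A}(X, ℂ) = ker (d_h d_{-1/h}) / (Im d_h + Im d_{-1/h})`. -/
abbrev HA (h : ℝ) (k : ℕ) : Type _ :=
  Subquotient (LinearMap.ker (dhdh E X h k)) (imA E X h k)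

variable (E X) in
/-- The `d_h`-cohomology `H^k_{d_h}(X, ℂ) = ker d_h / Im d_h`. -/
abbrev Hdh (h : ℝ) (k : ℕ) : Type _ :=
  Subquotient (LinearMap.ker (dh E X h k)) (imDh E X h k)

variable (E X) in
/-- The canonical map `H^k_{h-BC} → H^k_{h-A}`, `[u] ↦ [u]`. -/
def bcToA (h : ℝ) (k : ℕ) : HBC E X h k →ₗ[ℂ] HA E X h k :=
  Subquotient.map (inf_le_right.trans (ker_dh_le h k)) ((imDhDh_le h k).trans le_sup_left)

variable (E X) in
/-- The canonical map `H^k_{h-BC} → H^k_{d_h}`, `[u] ↦ [u]`. -/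
def bcToDh (h : ℝ) (k : ℕ) : HBC E X h k →ₗ[ℂ] Hdh E X h k :=
  Subquotient.map inf_le_left (imDhDh_le h k)

variable (E X) in
/-- The canonical map from `H^k_{h-BC}` to the `d_{-1/h}`-cohomology, `[u] ↦ [u]`. -/
def bcToDhInv (h : ℝ) (k : ℕ) : HBC E X h k →ₗ[ℂ] Hdh E X (-h⁻¹) k :=
  Subquotient.map inf_le_right (imDhDh_le' h k)

variable (E X) in
/-- Property `(L_k)`: for every `k`-form `u ∈ ker d_h ∩ ker d_{-1/h}` the conditions `u ∈ Im d_h`,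
`u ∈ Im d_{-1/h}`, `u ∈ Im (d_h d_{-1/h})` and `u ∈ Im ∂∂̄` are equivalent. -/
def PropertyL (h : ℝ) (k : ℕ) : Prop :=
  ∀ u ∈ kerBC E X h k,
    [u ∈ imDh E X h k, u ∈ imDh E X (-h⁻¹) k, u ∈ imDhDh E X h k, u ∈ imDelDelbar E X k].TFAE

variable (E X) in
/-- Property `(A_k)`: the canonical map `H^k_{h-BC} → H^k_{h-A}` is injective. -/
def PropertyA (h : ℝ) (k : ℕ) : Prop := Function.Injective (bcToA E X h k)

variable (E X) in
/-- Property `(B_k)`: the canonical map `H^k_{h-BC} → H^k_{h-A}` is surjective. -/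
def PropertyB (h : ℝ) (k : ℕ) : Prop := Function.Surjective (bcToA E X h k)

variable (E X) in
/-- Property `(C_k)`: the canonical maps from `H^k_{h-BC}` to the `d_{-1/h}`-cohomology and to the
`d_h`-cohomology are injective. -/
def PropertyC (h : ℝ) (k : ℕ) : Prop :=
  Function.Injective (bcToDhInv E X h k) ∧ Function.Injective (bcToDh E X h k)

variable (E X) in
/-- Property `(D'_k)`: `Im d_h + ker d_{-1/h} = ker (d_h d_{-1/h})` and
`Im d_{-1/h} + ker d_h = ker (d_h d_{-1/h})` as spaces of `k`-forms. -/
def PropertyD (h : ℝ) (k : ℕ) : Prop :=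
  imDh E X h k ⊔ LinearMap.ker (dh E X (-h⁻¹) k) = LinearMap.ker (dhdh E X h k) ∧
  imDh E X (-h⁻¹) k ⊔ LinearMap.ker (dh E X h k) = LinearMap.ker (dhdh E X h k)

end Aux

end Manifold
end
end ComplexForms

namespace ComplexForms

/-! ### Maps between subquotients, in terms of representatives. -/

section Subquotient

variable {V : Type*} [AddCommGroup V] [Module ℂ V] {Z Z' B B' : Submodule ℂ V}

/-! The result is linear algebra for two anticommuting differentials. Write `d = d_h` and `d' =
d_{-1/h}`. Then `d² = d'² = 0` and `dd' = -d'd`, so `Im dd'` lies in both images and each image lies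
in both `ker dd'` and the kernel of its own operator. Moreover `dd' = (h + 1/h) ∂∂̄` with a nonzero
factor, so `∂∂̄` may be replaced by `dd'` throughout.

On representatives, (L) and (C) become the same pair of implications: a form closed for both
operators and exact for one of them lies in `Im dd'`. (A) reduces to (C) because the two summands of
a form in `Im d + Im d'` that is closed for both operators are themselves closed for both
(`propertyA_iff_propertyC`).

The drop in degree comes from `d'(Im d) = Im dd'`: a form `v` lies in `Im d + ker d'` exactly when
`d'v` lies in `Im dd'`. Thus (D') in degree `k` is (C) in degree `k + 1` applied to `d'v` and `dv`
(`propertyC_succ_iff_propertyD`). Finally, (D') and (B) are two ways of splitting a form in `ker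
dd'`; using both equalities of (D') in succession leaves a remainder closed for both operators
(`propertyD_iff_propertyB`). -/

lemma Subquotient.map_injective_iff (hZ : Z ≤ Z') (hB : B ≤ B') :
    Function.Injective (Subquotient.map hZ hB) ↔ ∀ u ∈ Z, u ∈ B' → u ∈ B := by
  rw [injective_iff_map_eq_zero]
  constructor
  · intro H u hu hu'
    have h0 := H (Submodule.Quotient.mk ⟨u, hu⟩) ((Submodule.Quotient.mk_eq_zero (B'.submoduleOf Z')).2 hu')
    exact (Submodule.Quotient.mk_eq_zero (B.submoduleOf Z)).1 h0
  · intro H x hx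
    obtain ⟨⟨u, hu⟩, rfl⟩ := Submodule.Quotient.mk_surjective _ x
    exact (Submodule.Quotient.mk_eq_zero _).2
      (H u hu ((Submodule.Quotient.mk_eq_zero (B'.submoduleOf Z')).1 hx))

lemma Subquotient.map_surjective_iff (hZ : Z ≤ Z') (hB : B ≤ B') :
    Function.Surjective (Subquotient.map hZ hB) ↔ ∀ u ∈ Z', ∃ z ∈ Z, u - z ∈ B' := by
  constructor
  · intro H u hu
    obtain ⟨x, hx⟩ := H (Submodule.Quotient.mk ⟨u, hu⟩)
    obtain ⟨⟨z, hz⟩, rfl⟩ := Submodule.Quotient.mk_surjective _ x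
    exact ⟨z, hz, (Submodule.Quotient.eq (B'.submoduleOf Z')).1 hx.symm⟩
  · intro H x
    obtain ⟨⟨u, hu⟩, rfl⟩ := Submodule.Quotient.mk_surjective _ x
    obtain ⟨z, hz, hzu⟩ := H u hu
    exact ⟨Submodule.Quotient.mk ⟨z, hz⟩, ((Submodule.Quotient.eq (B'.submoduleOf Z')).2 hzu).symm⟩

end Subquotient

lemma eq_zero_of_add_self {V : Type*} [AddCommGroup V] [Module ℂ V] {v : V} (h : v + v = 0) :
    v = 0 := by
  rw [← two_smul ℂ] at h
  exact (smul_eq_zero.1 h).resolve_left two_ne_zero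

/-! ### Identities for `d_h` and `d_{-1/h}`, and their images and kernels. -/

section Operators

variable {E : Type*} [NormedAddCommGroup E] [NormedSpace ℂ E]
  {X : Type*} [TopologicalSpace X] [ChartedSpace E X] [IsManifold 𝓘(ℂ, E) ω X]

lemma dh_dh (a : ℝ) (k : ℕ) (u : Form E X k) : dh E X a (k + 1) (dh E X a k u) = 0 :=
  eq_zero_of_add_self (dh_anticomm a a k u)

lemma dh_comm (a b : ℝ) (k : ℕ) (u : Form E X k) :
    dh E X a (k + 1) (dh E X b k u) = -dh E X b (k + 1) (dh E X a k u) :=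
  eq_neg_of_add_eq_zero_left (dh_anticomm a b k u)

lemma imDh_le_ker (a : ℝ) (k : ℕ) : imDh E X a k ≤ LinearMap.ker (dh E X a k) := by
  match k with
  | 0 => exact bot_le
  | k + 1 =>
    rintro _ ⟨v, rfl⟩
    exact dh_dh a k v

lemma ker_dh_le_ker_dhdh (h : ℝ) (k : ℕ) :
    LinearMap.ker (dh E X h k) ≤ LinearMap.ker (dhdh E X h k) := by
  intro u hu
  rw [LinearMap.mem_ker] at hu ⊢
  change dh E X h (k + 1) (dh E X (-h⁻¹) k u) = 0
  rw [dh_comm, hu, map_zero, neg_zero]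

/-- `d_{-1/h}` maps `Im d_h` onto `Im (d_h d_{-1/h})`. -/
lemma map_dh_inv_imDh (h : ℝ) (k : ℕ) :
    (imDh E X h k).map (dh E X (-h⁻¹) k) = imDhDh E X h (k + 1) := by
  match k with
  -- No forms have degree -1, so the image in degree 0 and the image of the composite in degree 1
  -- are both zero.
  | 0 => exact Submodule.map_bot _
  | k + 1 =>
    change (LinearMap.range _).map _ = LinearMap.range _
    have e : dhdh E X h k = -(dh E X (-h⁻¹) (k + 1) ∘ₗ dh E X h k) :=
      LinearMap.ext fun u => dh_comm h (-h⁻¹) k u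
    rw [e, LinearMap.range_neg, LinearMap.range_comp]

/-- `d_h` maps `Im d_{-1/h}` onto `Im (d_h d_{-1/h})`. -/
lemma map_dh_imDh_inv (h : ℝ) (k : ℕ) :
    (imDh E X (-h⁻¹) k).map (dh E X h k) = imDhDh E X h (k + 1) := by
  match k with
  | 0 => exact Submodule.map_bot _
  | k + 1 => exact (LinearMap.range_comp _ _).symm

/-- `d_h d_{-1/h} = (h + 1/h) ∂∂̄`. -/
lemma dhdh_eq_smul (h : ℝ) (k : ℕ) :
    dhdh E X h k = ((h + h⁻¹ : ℝ) : ℂ) • (del E X (k + 1) ∘ₗ delbar E X k) := by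
  refine LinearMap.ext fun u => ?_
  have h1 : del E X (k + 1) (del E X k u) = 0 :=
    eq_zero_of_add_self (dOp_anticomm _ _ k u)
  have h2 : delbar E X (k + 1) (delbar E X k u) = 0 :=
    eq_zero_of_add_self (dOp_anticomm _ _ k u)
  have h3 : delbar E X (k + 1) (del E X k u) = -del E X (k + 1) (delbar E X k u) :=
    eq_neg_of_add_eq_zero_left (dOp_anticomm _ _ k u)
  simp only [dhdh, dh, LinearMap.comp_apply, LinearMap.add_apply, LinearMap.smul_apply, map_add,
    map_smul, h1, h2, h3]
  push_cast
  module

lemma imDhDh_eq_imDelDelbar {h : ℝ} (hh : h ≠ 0) (k : ℕ) :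
    imDhDh E X h k = imDelDelbar E X k := by
  match k with
  | 0 => rfl
  | 1 => rfl
  | k + 2 =>
    -- Reality of `h` matters here: `h² + 1` would vanish at `h = ±i`.
    have hc : ((h + h⁻¹ : ℝ) : ℂ) ≠ 0 := by
      have : h + h⁻¹ = (h ^ 2 + 1) / h := by field_simp
      rw [Complex.ofReal_ne_zero, this]
      positivity
    change LinearMap.range _ = LinearMap.range _
    rw [dhdh_eq_smul, LinearMap.range_smul _ _ hc]

/-! ### The properties in terms of representatives. -/

/-- Since `Im (d_h d_{-1/h})` is contained in both images and equals `Im ∂∂̄`, only two of the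
implications have content. -/
lemma propertyL_iff {h : ℝ} (hh : h ≠ 0) (k : ℕ) :
    PropertyL E X h k ↔ ∀ u ∈ kerBC E X h k,
      (u ∈ imDh E X h k → u ∈ imDhDh E X h k) ∧
      (u ∈ imDh E X (-h⁻¹) k → u ∈ imDhDh E X h k) := by
  refine forall₂_congr fun u _ => ⟨fun H => ⟨(H.out 0 2).1, (H.out 1 2).1⟩, fun H => ?_⟩
  rw [← imDhDh_eq_imDelDelbar hh]
  tfae_have 1 → 3 := H.1
  tfae_have 2 → 3 := H.2
  tfae_have 3 → 1 := fun hu => imDhDh_le h k hu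
  tfae_have 3 → 2 := fun hu => imDhDh_le' h k hu
  tfae_have 3 ↔ 4 := Iff.rfl
  tfae_finish

lemma propertyC_iff (h : ℝ) (k : ℕ) :
    PropertyC E X h k ↔ ∀ u ∈ kerBC E X h k,
      (u ∈ imDh E X h k → u ∈ imDhDh E X h k) ∧
      (u ∈ imDh E X (-h⁻¹) k → u ∈ imDhDh E X h k) := by
  rw [PropertyC, bcToDhInv, bcToDh, Subquotient.map_injective_iff, Subquotient.map_injective_iff]
  exact ⟨fun H u hu => ⟨H.2 u hu, H.1 u hu⟩,
    fun H => ⟨fun u hu => (H u hu).2, fun u hu => (H u hu).1⟩⟩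

lemma propertyA_iff (h : ℝ) (k : ℕ) :
    PropertyA E X h k ↔ ∀ u ∈ kerBC E X h k, u ∈ imA E X h k → u ∈ imDhDh E X h k :=
  Subquotient.map_injective_iff _ _

lemma propertyB_iff (h : ℝ) (k : ℕ) :
    PropertyB E X h k ↔ ∀ u ∈ LinearMap.ker (dhdh E X h k),
      ∃ z ∈ kerBC E X h k, u - z ∈ imA E X h k :=
  Subquotient.map_surjective_iff _ _

/-! ### The equivalences between the properties. -/

lemma propertyA_iff_propertyC (h : ℝ) (k : ℕ) :
    PropertyA E X h (k + 1) ↔ PropertyC E X h (k + 1) := by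
  rw [propertyA_iff, propertyC_iff]
  constructor
  · exact fun H u hu => ⟨fun h1 => H u hu (Submodule.mem_sup_left h1),
      fun h1 => H u hu (Submodule.mem_sup_right h1)⟩
  · rintro H u ⟨hu, hu'⟩ h1
    obtain ⟨a, ha, b, hb, rfl⟩ := Submodule.mem_sup.1 h1
    -- Each summand is closed for its own operator; since the sum is closed for both, subtracting
    -- the other summand makes each closed for both.
    have ha' := imDh_le_ker h _ ha
    have hb' := imDh_le_ker (-h⁻¹) _ hb
    have ha'' := (Submodule.add_mem_iff_left _ hb').1 hu'
    have hb'' := (Submodule.add_mem_iff_right _ ha').1 hu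
    exact add_mem ((H a ⟨ha', ha''⟩).1 ha) ((H b ⟨hb'', hb'⟩).2 hb)

/-- An exact form of degree `k + 1` is `d_{-1/h} v` or `d_h v`. It is already closed for the
operator that produced it, and being closed for the other means exactly `v ∈ ker (d_h d_{-1/h})`, up
to a sign in the second case. -/
lemma propertyC_succ_iff_propertyD (h : ℝ) (k : ℕ) :
    PropertyC E X h (k + 1) ↔ PropertyD E X h k := by
  have le1 : imDh E X h k ⊔ LinearMap.ker (dh E X (-h⁻¹) k) ≤ LinearMap.ker (dhdh E X h k) :=
    sup_le ((imDh_le_ker h k).trans (ker_dh_le_ker_dhdh h k)) (ker_dh_le h k)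
  have le2 : imDh E X (-h⁻¹) k ⊔ LinearMap.ker (dh E X h k) ≤ LinearMap.ker (dhdh E X h k) :=
    sup_le ((imDh_le_ker _ k).trans (ker_dh_le h k)) (ker_dh_le_ker_dhdh h k)
  rw [propertyC_iff, PropertyD]
  -- By `p ⊔ ker f = comap f (map f p)`, both sums become preimages of `Im (d_h d_{-1/h})`, under
  -- `d_{-1/h}` and `d_h` respectively.
  simp only [← Submodule.comap_map_eq, map_dh_inv_imDh, map_dh_imDh_inv] at le1 le2 ⊢
  constructor
  · refine fun H => ⟨le1.antisymm fun v hv => ?_, le2.antisymm fun v hv => ?_⟩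
    · exact (H _ ⟨hv, dh_dh _ k v⟩).2 ⟨v, rfl⟩
    · refine (H _ ⟨dh_dh _ k v, ?_⟩).1 ⟨v, rfl⟩
      rw [SetLike.mem_coe, LinearMap.mem_ker, dh_comm, neg_eq_zero]
      exact hv
  · rintro ⟨H1, H2⟩ u ⟨hu, hu'⟩
    constructor
    · rintro ⟨v, rfl⟩
      rw [SetLike.mem_coe, LinearMap.mem_ker, dh_comm, neg_eq_zero] at hu'
      exact H2.ge hu'
    · rintro ⟨v, rfl⟩
      exact H1.ge hu

lemma propertyD_iff_propertyB (h : ℝ) (k : ℕ) : PropertyD E X h k ↔ PropertyB E X h k := by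
  rw [propertyB_iff]
  constructor
  · rintro ⟨H1, H2⟩ v hv
    obtain ⟨a, ha, b, hb, rfl⟩ := Submodule.mem_sup.1 (H1.ge hv)
    obtain ⟨c, hc, e, he, rfl⟩ := Submodule.mem_sup.1 (H2.ge (ker_dh_le h k hb))
    -- Here `v = a + c + e`. Both `c + e` and `c` are killed by `d_{-1/h}`, hence so is `e`.
    refine ⟨e, ⟨he, (Submodule.add_mem_iff_right _ (imDh_le_ker _ _ hc)).1 hb⟩, ?_⟩
    rw [← add_assoc, add_sub_cancel_right]
    exact Submodule.add_mem_sup ha hc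
  · intro H
    refine ⟨le_antisymm (sup_le ((imDh_le_ker h k).trans (ker_dh_le_ker_dhdh h k))
        (ker_dh_le h k)) fun v hv => ?_,
      le_antisymm (sup_le ((imDh_le_ker _ k).trans (ker_dh_le h k))
        (ker_dh_le_ker_dhdh h k)) fun v hv => ?_⟩
    -- One decomposition `v = a + b + z` serves both equalities: `z` lies in both kernels, so it is
    -- grouped with `b` in `ker d_{-1/h}` or with `a` in `ker d_h`.
    all_goals
      obtain ⟨z, ⟨hz, hz'⟩, hvz⟩ := H v hv
      obtain ⟨a, ha, b, hb, hab⟩ := Submodule.mem_sup.1 hvz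
    · rw [← sub_add_cancel v z, ← hab, add_assoc]
      exact Submodule.add_mem_sup ha (add_mem (imDh_le_ker _ _ hb) hz')
    · rw [← sub_add_cancel v z, ← hab, add_comm a b, add_assoc]
      exact Submodule.add_mem_sup hb (add_mem (imDh_le_ker _ _ ha) hz)

end Operators

end ComplexForms

theorem proposition4p17 (E : Type*) [NormedAddCommGroup E] [NormedSpace ℂ E]
    [FiniteDimensional ℂ E] (X : Type*) [TopologicalSpace X] [T2Space X] [CompactSpace X]
    [ChartedSpace E X] [IsManifold 𝓘(ℂ, E) ω X] (h : ℝ) (hh : h ≠ 0) (k : ℕ) (hk : 1 ≤ k) :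
    [ComplexForms.PropertyL E X h k,
      ComplexForms.PropertyA E X h k,
      ComplexForms.PropertyC E X h k,
      ComplexForms.PropertyD E X h (k - 1),
      ComplexForms.PropertyB E X h (k - 1)].TFAE := by
  -- Passing to `k + 1` turns the truncated `k - 1` into a genuine predecessor.
  obtain ⟨k, rfl⟩ := Nat.exists_eq_add_of_le' hk
  rw [Nat.add_sub_cancel]
  tfae_have 1 ↔ 3 :=
    (ComplexForms.propertyL_iff hh (k + 1)).trans (ComplexForms.propertyC_iff h (k + 1)).symm
  tfae_have 2 ↔ 3 := ComplexForms.propertyA_iff_propertyC h k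
  tfae_have 3 ↔ 4 := ComplexForms.propertyC_succ_iff_propertyD h k
  tfae_have 4 ↔ 5 := ComplexForms.propertyD_iff_propertyB h k
  tfae_finish
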